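/- Let $S\subset\mathbb R^d$ be a nondegenerate $d$-simplex containing the instance space. The stage-$0$ subdivision of $S$ is $S$ itself; at each later stage every simplex present is split, at its barycenter, into $d+1$ subsimplices. The points of the $q$-stage uniform subdivision are the vertices of $S$ together with the barycenters of all simplices present at stages $0,\dots,q-1$. The embedding $\phi_q$ maps $x\in S$ to the vector indexed by these points whose coordinates at the vertices of the stage-$q$ simplex containing $x$ are the barycentric coordinates of $x$ in that simplex, and whose other coordinates are $0$. The uniform-subdivision classifier stopped at stage $q$ with weight vector $w$ is $h_{q,w}(x)=\operatorname{sign}(w\cdot\phi_q(x))$ (with $\operatorname{sign}(0)=0$, so that a tie counts as an error); the margin of a labelled point $(x,y)$, $y\in\{-1,1\}$, is $y\,w\cdot\phi_q(x)/\|w\|_2$ (and $0$ if $w=0$). Theorem. There is a universal constant $C>0$ such that the following holds for every such $d$ and $S$, every probability distribution $D$ on $S\times\{-1,1\}$, every $n\ge1$ and every $\delta\in(0,1)$. With probability at least $1-\delta$ over an i.i.d. sample of size $n$ from $D$, simultaneously for all stages $q\ge1$, all weight vectors $w$ and all $\gamma>0$ (so that $q$, $w$ and $\gamma$ may be chosen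 depending on the sample, for instance $w$ by soft SVM and $q$ by cross-validation), the generalization error $R=\Pr_{(x,y)\sim D}[h_{q,w}(x)\ne y]$ satisfies $$R\;\le\;\hat R+C\left(\frac{1}{\gamma\sqrt n}+\sqrt{\frac{\log(q/\delta)}{n}}\right),$$ where $\hat R$ is the fraction of the sample points whose margin is less than $\gamma$. -/

import Mathlib

open MeasureTheory

namespace NestedBarycentric

/-- A nondegenerate simplex in `ℝ^d`, given by its `d + 1` affinely independent vertices.
`b i` is the `i`-th vertex, and `b.coord i x` is the `i`-th barycentric coordinate of `x`. -/
abbrev Cell (d : ℕ) : Type := AffineBasis (Fin (d + 1)) ℝ (EuclideanSpace ℝ (Fin d))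

/-- The region occupied by a simplex. -/
def Cell.region {d : ℕ} (b : Cell d) : Set (EuclideanSpace ℝ (Fin d)) :=
  convexHull ℝ (Set.range b)

/-- The barycenter of a simplex. -/
noncomputable def Cell.barycenter {d : ℕ} (b : Cell d) : EuclideanSpace ℝ (Fin d) :=
  Finset.univ.centroid ℝ b

theorem Cell.isUnit_toMatrix_update {d : ℕ} (b : Cell d) (j : Fin (d + 1)) :
    IsUnit (b.toMatrix (Function.update b j b.barycenter)) := by
  have h : b.toMatrix (Function.update b j b.barycenter)
      = (1 : Matrix (Fin (d + 1)) (Fin (d + 1)) ℝ).updateRow j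
          (fun _ => ((d : ℝ) + 1)⁻¹) := by
    ext i k
    by_cases hij : i = j
    · subst hij
      rw [AffineBasis.toMatrix_apply, Function.update_self, Matrix.updateRow_self]
      have hw : ∑ i ∈ (Finset.univ : Finset (Fin (d + 1))),
          Finset.univ.centroidWeights ℝ i = 1 :=
        Finset.sum_centroidWeights_eq_one_of_nonempty ℝ _ Finset.univ_nonempty
      rw [Cell.barycenter, Finset.centroid_def,
        b.coord_apply_combination_of_mem (Finset.mem_univ k) hw]
      simp [Finset.centroidWeights_apply]
    · rw [AffineBasis.toMatrix_apply, Function.update_of_ne hij, Matrix.updateRow_ne hij,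
        AffineBasis.coord_apply, Matrix.one_apply]
      simp [eq_comm]
  rw [h, Matrix.isUnit_iff_isUnit_det]
  have h2 : (fun _ => ((d : ℝ) + 1)⁻¹ : Fin (d + 1) → ℝ)
      = ∑ k, ((d : ℝ) + 1)⁻¹ • (1 : Matrix (Fin (d + 1)) (Fin (d + 1)) ℝ) k := by
    ext i
    simp [Matrix.one_apply]
  rw [h2, Matrix.det_updateRow_sum]
  simp only [Matrix.det_one, smul_eq_mul, mul_one, isUnit_iff_ne_zero]
  positivity

/-- The `j`-th of the `d + 1` subsimplices obtained by splitting a simplex at its barycenter: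
the `j`-th vertex is replaced by the barycenter. -/
noncomputable def Cell.split {d : ℕ} (b : Cell d) (j : Fin (d + 1)) : Cell d where
  toFun := Function.update b j b.barycenter
  ind' := ((b.isUnit_toMatrix_iff _).1 (b.isUnit_toMatrix_update j)).1
  tot' := ((b.isUnit_toMatrix_iff _).1 (b.isUnit_toMatrix_update j)).2

open Classical in
/-- The simplices present at stage `q` of the uniform subdivision of `S`. -/
noncomputable def cells {d : ℕ} (S : Cell d) : ℕ → Finset (Cell d)
  | 0 => {S}
  | q + 1 => (cells S q).biUnion fun b => Finset.univ.image fun j => b.split j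

open Classical in
/-- The points of the `q`-stage uniform subdivision of `S`: the vertices of `S`, and the
barycenters of all the simplices present at stages `0, …, q - 1`. -/
noncomputable def points {d : ℕ} (S : Cell d) : ℕ → Finset (EuclideanSpace ℝ (Fin d))
  | 0 => Finset.univ.image S
  | q + 1 => points S q ∪ (cells S q).image Cell.barycenter

open Classical in
/-- The first subsimplex of `b` that contains `x`. (For `x` in no subsimplex, that is, `x`
outside `b`, the value is irrelevant.) -/
noncomputable def Cell.child {d : ℕ} (b : Cell d) (x : EuclideanSpace ℝ (Fin d)) : Cell d :=
  if h : ∃ j, x ∈ (b.split j).region then b.split (Fin.find _ h) else b.split 0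

/-- The simplex of stage `q` that contains the point `x` of `S`, found by a top-down search.
(On a face common to several simplices the choice among them does not affect the embedding.) -/
noncomputable def locate {d : ℕ} (S : Cell d) : ℕ → EuclideanSpace ℝ (Fin d) → Cell d
  | 0, _ => S
  | q + 1, x => (locate S q x).child x

/-- The embedding of `x` by the `q`-stage uniform subdivision. It has one coordinate for each
point of the subdivision; at the vertices of the simplex containing `x` these are the
barycentric coordinates of `x` in that simplex, and all the others are zero. -/
noncomputable def embed {d : ℕ} (S : Cell d) (q : ℕ) (x : EuclideanSpace ℝ (Fin d)) :
    EuclideanSpace ℝ (points S q) :=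
  open Classical in
  WithLp.toLp 2 fun p =>
    ∑ i, if locate S q x i = (p : EuclideanSpace ℝ (Fin d)) then (locate S q x).coord i x else 0

/-- The linear classifier on the embedded space with weight vector `w`. -/
noncomputable def classifier {d : ℕ} (S : Cell d) (q : ℕ) (w : EuclideanSpace ℝ (points S q))
    (x : EuclideanSpace ℝ (Fin d)) : ℝ :=
  Real.sign (inner ℝ w (embed S q x))

/-- The (geometric, signed) margin of the labelled point `z = (x, y)` with respect to the
hyperplane through the origin of the embedded space with normal vector `w`. -/
noncomputable def margin {d : ℕ} (S : Cell d) (q : ℕ) (w : EuclideanSpace ℝ (points S q))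
    (z : EuclideanSpace ℝ (Fin d) × ℝ) : ℝ :=
  z.2 * inner ℝ w (embed S q z.1) / ‖w‖

/-- The fraction of the sample points whose margin is less than `γ`. -/
noncomputable def empiricalMarginError {d n : ℕ} (S : Cell d) (q : ℕ)
    (w : EuclideanSpace ℝ (points S q)) (γ : ℝ)
    (z : Fin n → EuclideanSpace ℝ (Fin d) × ℝ) : ℝ :=
  (Nat.card {i : Fin n // margin S q w (z i) < γ} : ℝ) / n

/-- The probability that the classifier errs on a labelled point drawn from `D`. -/
noncomputable def generalizationError {d : ℕ} (S : Cell d) (q : ℕ)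
    (w : EuclideanSpace ℝ (points S q)) (D : Measure (EuclideanSpace ℝ (Fin d) × ℝ)) : ℝ :=
  D.real {z | classifier S q w z.1 ≠ z.2}

end NestedBarycentric

/-!
The proof works with the vectors `y • φ_q(x)`. On `S × {-1, 1}` they have norm at most `1`: the
coordinates of `φ_q(x)` are barycentric coordinates of `x` in a simplex that contains it
(`mem_region_locate`, `norm_embed_le`). So neither the dimension `d` nor the stage `q`, and hence
not the number of coordinates of the embedding, enters the margin bound for linear functionals of
norm at most `1`, applied at a fixed stage.

For a fixed stage and a fixed scale `γ`, the error indicator is bounded by the ramp loss of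
`⟪w, X⟫ / γ`, which in turn is bounded by the indicator of a margin less than `γ`. The supremum
over `w` of the deviation of the empirical ramp loss from its mean is within
`√(log (1 / δ) / (2 n))` of its expectation with probability `1 - δ`, by the bounded differences
inequality (`measureReal_integral_add_le_of_boundedDifferences`), which follows from Hoeffding's
lemma by induction over the coordinates.

The expectation is bounded in `integral_ciSup_inner_add_sum_deviation_le`, again by induction over
the sample points. For one point, `⨆ (g + 𝔼 f - f x)` is at most the average of `𝔼 ⨆ (g + 2 f)` and
`⨆ (g - 2 f x)`; since `f` is a Lipschitz function of `⟪w, X x⟫` with constant `K = 1 / γ`, it can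
be replaced by `K ⟪w, X x⟫` in the sum of these two suprema. Thus each sample point adds
`± 2 K X x` to a vector `v`, and the mean of `‖v‖²` grows by at most `4 K²`. After `n` points the
supremum of `⟪w, v⟫` over the unit ball has mean at most `2 K √n`.

The scales are reduced to the dyadic ones, where the scale `2 ^ (-(k + 1))` gets the share
`2 ^ (-(k + 1))` of `δ`; its cost `√((k + 1) / n)` is absorbed by `1 / (γ √n)`. Stage `q` gets
the share `1 / (q (q + 1))`, whose cost is absorbed by `√(log (q / δ) / n)` and, because of the constant
factors, by `1 / √n ≤ 1 / (γ √n)`. Scales `γ > 1` and `w = 0` are trivial, since all sample points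
then have margin less than `γ`.
-/

open ProbabilityTheory

open scoped NNReal

namespace NestedBarycentric

/-! ### Suprema of uniformly bounded families -/

section Suprema

variable {ι : Type*} {f g : ι → ℝ} {B : ℝ}

theorem bddAbove_range_of_abs_le (h : ∀ i, |f i| ≤ B) : BddAbove (Set.range f) :=
  ⟨B, by rintro _ ⟨i, rfl⟩; exact (abs_le.1 (h i)).2⟩

theorem abs_ciSup_le_of_abs_le [Nonempty ι] (h : ∀ i, |f i| ≤ B) : |⨆ i, f i| ≤ B := by
  obtain ⟨i⟩ := ‹Nonempty ι›
  refine abs_le.2 ⟨?_, ciSup_le fun i => (abs_le.1 (h i)).2⟩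
  exact (abs_le.1 (h i)).1.trans (le_ciSup (bddAbove_range_of_abs_le h) i)

/-- If `f` is 1-Lipschitz as a function of `a`, then replacing `f` by `a` does not decrease
the average of `⨆ i, (g i ± f i)` over the two signs. -/
theorem ciSup_add_add_ciSup_sub_le [Nonempty ι] {a : ι → ℝ}
    (hg : ∀ i, |g i| ≤ B) (ha : ∀ i, |a i| ≤ B) (hf : ∀ i j, |f i - f j| ≤ |a i - a j|) :
    (⨆ i, (g i + f i)) + (⨆ i, (g i - f i)) ≤ (⨆ i, (g i + a i)) + (⨆ i, (g i - a i)) := by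
  have hadd : ∀ i, g i + a i ≤ ⨆ i, (g i + a i) :=
    le_ciSup (bddAbove_range_of_abs_le (B := B + B) fun i =>
      (abs_add_le _ _).trans (add_le_add (hg i) (ha i)))
  have hsub : ∀ i, g i - a i ≤ ⨆ i, (g i - a i) :=
    le_ciSup (bddAbove_range_of_abs_le (B := B + B) fun i =>
      (abs_sub _ _).trans (add_le_add (hg i) (ha i)))
  suffices h : ∀ i j, (g i + f i) + (g j - f j) ≤ (⨆ i, (g i + a i)) + (⨆ i, (g i - a i)) by
    rw [← le_sub_iff_add_le]
    refine ciSup_le fun i => ?_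
    rw [le_sub_comm]
    exact ciSup_le fun j => by linarith [h i j]
  intro i j
  have h1 := (le_abs_self _).trans (hf i j)
  rcases abs_cases (a i - a j) with ⟨h, -⟩ | ⟨h, -⟩
  · linarith [hadd i, hsub j]
  · linarith [hadd j, hsub i]

end Suprema

/-! ### Integrals over finite powers of a probability space -/

section Power

variable {Ω : Type*} [MeasurableSpace Ω] {D : Measure Ω} [IsProbabilityMeasure D]

theorem integrable_of_abs_le {α : Type*} [MeasurableSpace α] {μ : Measure α} [IsFiniteMeasure μ]
    {F : α → ℝ} {B : ℝ} (hF : Measurable F) (hB : ∀ x, |F x| ≤ B) : Integrable F μ :=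
  .of_bound hF.aestronglyMeasurable B (.of_forall hB)

theorem abs_integral_le_of_abs_le {α : Type*} [MeasurableSpace α] {μ : Measure α}
    [IsProbabilityMeasure μ] {F : α → ℝ} {B : ℝ} (hB : ∀ x, |F x| ≤ B) : |∫ x, F x ∂μ| ≤ B := by
  simpa using norm_integral_le_of_norm_le_const (μ := μ) (f := F) (.of_forall hB)

theorem measurable_finCons {n : ℕ} :
    Measurable fun p : Ω × (Fin n → Ω) => (Fin.cons p.1 p.2 : Fin (n + 1) → Ω) :=
  measurable_pi_iff.2 <| Fin.cases (by simpa using measurable_fst)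
    fun j => by simpa using! (measurable_pi_apply j).comp measurable_snd

/-- Fubini for a power of a probability space, with the first coordinate split off. -/
theorem integral_pi_finSucc {n : ℕ} {F : (Fin (n + 1) → Ω) → ℝ} {B : ℝ}
    (hF : Measurable F) (hB : ∀ z, |F z| ≤ B) :
    ∫ z, F z ∂(Measure.pi fun _ => D) =
      ∫ x, ∫ z, F (Fin.cons x z) ∂(Measure.pi fun _ => D) ∂D := by
  rw [← ((measurePreserving_piFinSuccAbove (fun _ : Fin (n + 1) => D) 0).symm).integral_comp']
  rw [integral_prod]
  · simp [MeasurableEquiv.piFinSuccAbove_symm_apply, Fin.insertNthEquiv]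
  · exact integrable_of_abs_le (hF.comp (MeasurableEquiv.measurable _)) fun z => hB _

end Power

/-! ### The bounded differences inequality -/

section BoundedDifferences

variable {Ω : Type*} [MeasurableSpace Ω] {D : Measure Ω} [IsProbabilityMeasure D]

/-- Hoeffding's lemma, for a function of oscillation at most `c`. -/
theorem integral_exp_sub_integral_le {g : Ω → ℝ} {B : ℝ} {c : ℝ≥0} (hg : Measurable g)
    (hB : ∀ x, |g x| ≤ B) (hc : ∀ x y, g x - g y ≤ c) (t : ℝ) :
    ∫ x, Real.exp (t * (g x - ∫ y, g y ∂D)) ∂D ≤ Real.exp (c ^ 2 / 4 * t ^ 2 / 2) := by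
  have : Nonempty Ω := D.nonempty_of_neZero
  have hbdd : BddBelow (Set.range g) :=
    ⟨-B, by rintro _ ⟨x, rfl⟩; exact (abs_le.1 (hB x)).1⟩
  have hmem : ∀ x, g x ∈ Set.Icc (⨅ y, g y) ((⨅ y, g y) + c) := fun x =>
    ⟨ciInf_le hbdd x, by
      rw [← sub_le_iff_le_add]
      exact le_ciInf fun y => by linarith [hc x y]⟩
  have h := (hasSubgaussianMGF_of_mem_Icc (μ := D) hg.aemeasurable (.of_forall hmem)).mgf_le t
  refine h.trans_eq ?_
  congr 3
  rw [add_sub_cancel_left]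
  push_cast
  rw [Real.norm_of_nonneg c.coe_nonneg]
  ring

/-- A function of `n` independent variables which varies by at most `c` in each of them has a
sub-Gaussian moment generating function. -/
theorem integral_exp_sub_integral_le_of_boundedDifferences {B : ℝ} {c : ℝ≥0} (t : ℝ) (n : ℕ) :
    ∀ {f : (Fin n → Ω) → ℝ}, Measurable f → (∀ z, |f z| ≤ B) →
      (∀ z i x, |f (Function.update z i x) - f z| ≤ c) →
      ∫ z, Real.exp (t * (f z - ∫ y, f y ∂(Measure.pi fun _ => D))) ∂(Measure.pi fun _ => D) ≤
        Real.exp (n * (c ^ 2 / 4 * t ^ 2 / 2)) := by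
  induction n with
  | zero =>
    intro f hf hB hd
    have : ∀ z, f z = f default := fun z => by rw [Subsingleton.elim z default]
    simp [this]
  | succ n ih =>
    intro f hf hB hd
    have hfc : Measurable fun p : Ω × (Fin n → Ω) => f (Fin.cons p.1 p.2) :=
      hf.comp measurable_finCons
    have hfx : ∀ x, Measurable fun z : Fin n → Ω => f (Fin.cons x z) := fun x =>
      hfc.comp measurable_prodMk_left
    -- `g` is the conditional expectation of `f` given the first variable.
    set g : Ω → ℝ := fun x => ∫ z, f (Fin.cons x z) ∂(Measure.pi fun _ => D) with hg
    have hgm : Measurable g := hfc.stronglyMeasurable.integral_prod_right.measurable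
    have hgB : ∀ x, |g x| ≤ B := fun x => abs_integral_le_of_abs_le fun z => hB _
    have hgd : ∀ x y, g x - g y ≤ c := by
      intro x y
      simp only [hg]
      rw [← integral_sub (integrable_of_abs_le (hfx x) fun z => hB _)
        (integrable_of_abs_le (hfx y) fun z => hB _)]
      refine (le_abs_self _).trans (abs_integral_le_of_abs_le fun z => ?_)
      simpa using hd (Fin.cons y z) 0 x
    rw [integral_pi_finSucc hf hB]
    set m := ∫ x, g x ∂D with hm
    have hmB : |m| ≤ B := abs_integral_le_of_abs_le hgB
    have hexp : ∀ u v : ℝ, |u| ≤ B → |v| ≤ B →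
        |Real.exp (t * (u - v))| ≤ Real.exp (|t| * (B + B)) := by
      intro u v hu hv
      rw [Real.abs_exp, Real.exp_le_exp]
      refine (le_abs_self _).trans ?_
      rw [abs_mul]
      exact mul_le_mul_of_nonneg_left ((abs_sub _ _).trans (add_le_add hu hv)) (abs_nonneg t)
    rw [integral_pi_finSucc (B := Real.exp (|t| * (B + B))) (by fun_prop)
      (fun z => hexp _ _ (hB z) hmB)]
    have hin : ∀ x, ∫ z, Real.exp (t * (f (Fin.cons x z) - m)) ∂(Measure.pi fun _ => D) ≤
        Real.exp (n * (c ^ 2 / 4 * t ^ 2 / 2)) * Real.exp (t * (g x - m)) := by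
      intro x
      have h1 : ∀ z : Fin n → Ω, Real.exp (t * (f (Fin.cons x z) - m)) =
          Real.exp (t * (f (Fin.cons x z) - g x)) * Real.exp (t * (g x - m)) := by
        intro z
        rw [← Real.exp_add]
        ring_nf
      simp only [h1]
      rw [integral_mul_const]
      refine mul_le_mul_of_nonneg_right ?_ (Real.exp_pos _).le
      refine ih (hfx x) (fun z => hB _) fun z i y => ?_
      simpa [Fin.cons_update] using hd (Fin.cons x z) i.succ y
    calc ∫ x, ∫ z, Real.exp (t * (f (Fin.cons x z) - m)) ∂(Measure.pi fun _ => D) ∂D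
        ≤ ∫ x, Real.exp (n * (c ^ 2 / 4 * t ^ 2 / 2)) * Real.exp (t * (g x - m)) ∂D := by
          refine integral_mono_of_nonneg
            (.of_forall fun x => integral_nonneg fun z => (Real.exp_pos _).le) ?_ (.of_forall hin)
          exact (integrable_of_abs_le (B := Real.exp (|t| * (B + B))) (by fun_prop)
            fun x => hexp _ _ (hgB x) hmB).const_mul _
      _ ≤ Real.exp (n * (c ^ 2 / 4 * t ^ 2 / 2)) * Real.exp (c ^ 2 / 4 * t ^ 2 / 2) := by
          rw [integral_const_mul]
          exact mul_le_mul_of_nonneg_left (integral_exp_sub_integral_le hgm hgB hgd t)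
            (Real.exp_pos _).le
      _ = Real.exp ((n + 1 : ℕ) * (c ^ 2 / 4 * t ^ 2 / 2)) := by
          rw [← Real.exp_add]
          push_cast
          ring_nf

/-- The bounded differences inequality (McDiarmid): a function of `n` independent variables which
varies by at most `c` in each of them exceeds its mean by `s` with probability at most
`exp (-2 s² / (n c²))`. -/
theorem measureReal_integral_add_le_of_boundedDifferences {B : ℝ} {c : ℝ≥0} {n : ℕ}
    {f : (Fin n → Ω) → ℝ} (hf : Measurable f) (hB : ∀ z, |f z| ≤ B)
    (hd : ∀ z i x, |f (Function.update z i x) - f z| ≤ c) {s : ℝ} (hs : 0 ≤ s) :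
    (Measure.pi fun _ => D).real {z | s ≤ f z - ∫ y, f y ∂(Measure.pi fun _ => D)} ≤
      Real.exp (-s ^ 2 / (2 * (n * (c ^ 2 / 4)))) := by
  have h : HasSubgaussianMGF (fun z => f z - ∫ y, f y ∂(Measure.pi fun _ => D))
      (n * (c ^ 2 / 4)) (Measure.pi fun _ => D) := by
    refine ⟨fun t => ?_, fun t => ?_⟩
    · refine integrable_exp_mul_of_mem_Icc (a := -(B + B)) (b := B + B)
        (by fun_prop) (.of_forall fun z => abs_le.1 ?_)
      exact (abs_sub _ _).trans (add_le_add (hB z) (abs_integral_le_of_abs_le hB))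
    · refine (integral_exp_sub_integral_le_of_boundedDifferences t n hf hB hd).trans_eq ?_
      push_cast
      ring_nf
  simpa using h.measure_ge_le hs

end BoundedDifferences

/-! ### The expected uniform deviation of Lipschitz functions of linear functionals -/

section UniformDeviation

variable {Ω : Type*} [MeasurableSpace Ω] {D : Measure Ω} [IsProbabilityMeasure D]
  {ι : Type*} [Countable ι] [Nonempty ι]
  {H : Type*} [NormedAddCommGroup H] [InnerProductSpace ℝ H] [MeasurableSpace H] [BorelSpace H]
  [SecondCountableTopology H]

/-- Symmetrization and contraction in a single variable. The deviation of `f i x` from its mean is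
replaced by `± 2 K ⟪w i, X x⟫` with a uniformly random sign. -/
theorem integral_ciSup_deviation_le {g : ι → ℝ} {B : ℝ} (hg : ∀ i, |g i| ≤ B)
    {f : ι → Ω → ℝ} (hf : ∀ i, Measurable (f i)) (hf1 : ∀ i x, |f i x| ≤ 1)
    {w : ι → H} (hw : ∀ i, ‖w i‖ ≤ 1) {X : Ω → H} (hX : Measurable X) (hX1 : ∀ x, ‖X x‖ ≤ 1)
    {K : ℝ} (hK : 0 ≤ K)
    (hfK : ∀ i j x, |f i x - f j x| ≤ K * |inner ℝ (w i) (X x) - inner ℝ (w j) (X x)|) :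
    ∫ x, ⨆ i, (g i + (∫ y, f i y ∂D - f i x)) ∂D ≤
      ∫ x, ((⨆ i, (g i + 2 * K * inner ℝ (w i) (X x))) +
        ⨆ i, (g i - 2 * K * inner ℝ (w i) (X x))) / 2 ∂D := by
  have hin : ∀ i x, |(inner ℝ (w i) (X x) : ℝ)| ≤ 1 := fun i x =>
    (abs_real_inner_le_norm _ _).trans (mul_le_one₀ (hw i) (norm_nonneg _) (hX1 x))
  have hin2 : ∀ i x, |2 * K * (inner ℝ (w i) (X x) : ℝ)| ≤ 2 * K := fun i x => by
    rw [abs_mul, abs_of_nonneg (by positivity : 0 ≤ 2 * K)]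
    exact mul_le_of_le_one_right (by positivity) (hin i x)
  have hf2 : ∀ i x, |2 * f i x| ≤ 2 := fun i x => by
    rw [abs_mul, abs_two]; linarith [hf1 i x]
  have hp : ∀ i x, |g i + 2 * f i x| ≤ B + 2 := fun i x =>
    (abs_add_le _ _).trans (add_le_add (hg i) (hf2 i x))
  have hm : ∀ i x, |g i - 2 * f i x| ≤ B + 2 := fun i x =>
    (abs_sub _ _).trans (add_le_add (hg i) (hf2 i x))
  have hip : Integrable (fun x => ⨆ i, (g i + 2 * f i x)) D :=
    integrable_of_abs_le (B := B + 2) (.iSup fun i => by fun_prop)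
      fun x => abs_ciSup_le_of_abs_le fun i => hp i x
  have him : Integrable (fun x => ⨆ i, (g i - 2 * f i x)) D :=
    integrable_of_abs_le (B := B + 2) (.iSup fun i => by fun_prop)
      fun x => abs_ciSup_le_of_abs_le fun i => hm i x
  have hmean : ∀ i, |∫ y, f i y ∂D| ≤ 1 := fun i => abs_integral_le_of_abs_le (hf1 i)
  calc ∫ x, ⨆ i, (g i + (∫ y, f i y ∂D - f i x)) ∂D
      ≤ ∫ x, ((∫ y, ⨆ i, (g i + 2 * f i y) ∂D) + ⨆ i, (g i - 2 * f i x)) / 2 ∂D := by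
        refine integral_mono (integrable_of_abs_le (B := B + 2) (.iSup fun i => by fun_prop)
          fun x => abs_ciSup_le_of_abs_le fun i => ?_)
          (((integrable_const _).add him).div_const 2) fun x => ciSup_le fun i => ?_
        · refine (abs_add_le _ _).trans (add_le_add (hg i) ((abs_sub _ _).trans ?_))
          linarith [hmean i, hf1 i x]
        · have h1 : g i + 2 * ∫ y, f i y ∂D ≤ ∫ y, ⨆ i, (g i + 2 * f i y) ∂D := by
            have : g i + 2 * ∫ y, f i y ∂D = ∫ y, (g i + 2 * f i y) ∂D := by
              rw [integral_add (integrable_const _)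
                ((integrable_of_abs_le (hf i) (hf1 i)).const_mul 2), integral_const_mul]
              simp
            rw [this]
            exact integral_mono (integrable_of_abs_le (by fun_prop) (hp i)) hip
              fun y => le_ciSup (bddAbove_range_of_abs_le fun i => hp i y) i
          have h2 : g i - 2 * f i x ≤ ⨆ i, (g i - 2 * f i x) :=
            le_ciSup (bddAbove_range_of_abs_le fun i => hm i x) i
          show g i + (∫ y, f i y ∂D - f i x) ≤
            ((∫ y, ⨆ i, (g i + 2 * f i y) ∂D) + ⨆ i, (g i - 2 * f i x)) / 2
          linarith
    _ = ∫ x, ((⨆ i, (g i + 2 * f i x)) + ⨆ i, (g i - 2 * f i x)) / 2 ∂D := by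
        rw [integral_div, integral_div, integral_add (integrable_const _) him,
          integral_add hip him]
        simp
    _ ≤ _ := by
        refine integral_mono ((hip.add him).div_const 2) ?_ fun x => ?_
        · refine Integrable.div_const (.add ?_ ?_) 2
          · exact integrable_of_abs_le (B := B + 2 * K) (.iSup fun i => by fun_prop)
              fun x => abs_ciSup_le_of_abs_le fun i =>
                (abs_add_le _ _).trans (add_le_add (hg i) (hin2 i x))
          · exact integrable_of_abs_le (B := B + 2 * K) (.iSup fun i => by fun_prop)
              fun x => abs_ciSup_le_of_abs_le fun i =>
                (abs_sub _ _).trans (add_le_add (hg i) (hin2 i x))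
        · refine div_le_div_of_nonneg_right ?_ zero_le_two
          refine ciSup_add_add_ciSup_sub_le (B := max B (2 * K))
            (fun i => (hg i).trans (le_max_left _ _))
            (fun i => (hin2 i x).trans (le_max_right _ _)) fun i j => ?_
          rw [← mul_sub, ← mul_sub, abs_mul, abs_mul, abs_two,
            abs_of_nonneg (by positivity : 0 ≤ 2 * K), mul_assoc]
          exact mul_le_mul_of_nonneg_left (hfK i j x) zero_le_two

/-- The bound `(√(‖v + u‖² + t) + √(‖v - u‖² + t)) / 2 ≤ √(‖v‖² + ‖u‖² + t)`, from concavity of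
the square root and the parallelogram law. -/
theorem sqrt_norm_add_add_sqrt_norm_sub_le {H : Type*} [NormedAddCommGroup H]
    [InnerProductSpace ℝ H] (v u : H) {t : ℝ} (ht : 0 ≤ t) :
    (√(‖v + u‖ ^ 2 + t) + √(‖v - u‖ ^ 2 + t)) / 2 ≤ √(‖v‖ ^ 2 + ‖u‖ ^ 2 + t) := by
  refine Real.le_sqrt_of_sq_le ?_
  have h1 := Real.sq_sqrt (by positivity : 0 ≤ ‖v + u‖ ^ 2 + t)
  have h2 := Real.sq_sqrt (by positivity : 0 ≤ ‖v - u‖ ^ 2 + t)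
  have h3 := parallelogram_law_with_norm ℝ v u
  nlinarith [sq_nonneg (√(‖v + u‖ ^ 2 + t) - √(‖v - u‖ ^ 2 + t))]

/-- Symmetrization and contraction, one sample point at a time. Starting from the functional
`⟪w i, v⟫`, each point contributes `± 2 K X x` to the vector `v`, and so at most `(2 K)²` to its
mean square norm. -/
theorem integral_ciSup_inner_add_sum_deviation_le
    {f : ι → Ω → ℝ} (hf : ∀ i, Measurable (f i)) (hf1 : ∀ i x, |f i x| ≤ 1)
    {w : ι → H} (hw : ∀ i, ‖w i‖ ≤ 1) {X : Ω → H} (hX : Measurable X) (hX1 : ∀ x, ‖X x‖ ≤ 1)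
    {K : ℝ} (hK : 0 ≤ K)
    (hfK : ∀ i j x, |f i x - f j x| ≤ K * |inner ℝ (w i) (X x) - inner ℝ (w j) (X x)|)
    (n : ℕ) : ∀ v : H,
    ∫ z, ⨆ i, (inner ℝ (w i) v + ∑ j, (∫ y, f i y ∂D - f i (z j)))
        ∂(Measure.pi fun _ : Fin n => D) ≤ √(‖v‖ ^ 2 + n * (2 * K) ^ 2) := by
  have hinv : ∀ i (v : H), |(inner ℝ (w i) v : ℝ)| ≤ ‖v‖ := fun i v =>
    (abs_real_inner_le_norm _ _).trans (mul_le_of_le_one_left (norm_nonneg _) (hw i))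
  have hdev : ∀ i x, |∫ y, f i y ∂D - f i x| ≤ 2 := fun i x =>
    (abs_sub _ _).trans (by linarith [abs_integral_le_of_abs_le (μ := D) (hf1 i), hf1 i x])
  have hsum : ∀ {n : ℕ} i (z : Fin n → Ω), |∑ j, (∫ y, f i y ∂D - f i (z j))| ≤ n * 2 :=
    fun i z => (Finset.abs_sum_le_sum_abs _ _).trans
      ((Finset.sum_le_sum fun j _ => hdev i (z j)).trans (by simp))
  have hall : ∀ {n : ℕ} i (v : H) (z : Fin n → Ω),
      |inner ℝ (w i) v + ∑ j, (∫ y, f i y ∂D - f i (z j))| ≤ ‖v‖ + n * 2 :=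
    fun i v z => (abs_add_le _ _).trans (add_le_add (hinv i v) (hsum i z))
  have hsupB : ∀ {n : ℕ} (v : H) (z : Fin n → Ω),
      |⨆ i, (inner ℝ (w i) v + ∑ j, (∫ y, f i y ∂D - f i (z j)))| ≤ ‖v‖ + n * 2 :=
    fun v z => abs_ciSup_le_of_abs_le fun i => hall i v z
  have hfz : ∀ {n : ℕ} (i : ι) (j : Fin n), Measurable fun z : Fin n → Ω => f i (z j) :=
    fun i j => (hf i).comp (measurable_pi_apply j)
  induction n with
  | zero =>
    intro v
    simpa [Real.sqrt_sq (norm_nonneg v)] using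
      ciSup_le fun i => (le_abs_self _).trans (hinv i v)
  | succ n ih =>
    intro v
    -- The functional after the first sample point `x` has contributed `2 K X x` with sign `s`.
    obtain ⟨Φ, hΦ⟩ : ∃ Φ : ℝ → Ω → (Fin n → Ω) → ℝ, ∀ s x z, Φ s x z =
        ⨆ i, (inner ℝ (w i) (v + s • ((2 * K) • X x)) + ∑ j, (∫ y, f i y ∂D - f i (z j))) :=
      ⟨_, fun _ _ _ => rfl⟩
    have hnorm : ∀ s : ℝ, |s| = 1 → ∀ x, ‖v + s • ((2 * K) • X x)‖ ≤ ‖v‖ + 2 * K := by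
      intro s hs x
      refine (norm_add_le _ _).trans (add_le_add le_rfl ?_)
      rw [norm_smul, norm_smul, Real.norm_eq_abs, hs, one_mul,
        Real.norm_of_nonneg (by positivity : 0 ≤ 2 * K)]
      exact mul_le_of_le_one_right (by positivity) (hX1 x)
    have hΦm : ∀ s, Measurable fun p : Ω × (Fin n → Ω) => Φ s p.1 p.2 := by
      intro s
      simp only [hΦ]
      refine .iSup fun i => .add ?_ ?_
      · fun_prop
      · exact Finset.measurable_sum _ fun j _ =>
          measurable_const.sub ((hfz i j).comp measurable_snd)
    have hΦB : ∀ s : ℝ, |s| = 1 → ∀ x z, |Φ s x z| ≤ ‖v‖ + 2 * K + n * 2 := fun s hs x z => by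
      rw [hΦ]
      exact (hsupB _ z).trans (by linarith [hnorm s hs x])
    have hΦi : ∀ s : ℝ, |s| = 1 → Integrable (fun p : Ω × (Fin n → Ω) => Φ s p.1 p.2)
        (D.prod (Measure.pi fun _ => D)) := fun s hs =>
      integrable_of_abs_le (hΦm s) fun p => hΦB s hs p.1 p.2
    have h1 : |(1 : ℝ)| = 1 := abs_one
    have h2 : |(-1 : ℝ)| = 1 := by simp
    have hΦavg : Integrable (fun p : Ω × (Fin n → Ω) => (Φ 1 p.1 p.2 + Φ (-1) p.1 p.2) / 2)
        (D.prod (Measure.pi fun _ => D)) := ((hΦi 1 h1).add (hΦi (-1) h2)).div_const 2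
    have hL : Measurable fun p : Ω × (Fin n → Ω) =>
        ⨆ i, (inner ℝ (w i) v +
          ∑ j, (∫ y, f i y ∂D - f i ((Fin.cons p.1 p.2 : Fin (n + 1) → Ω) j))) :=
      .iSup fun i => measurable_const.add <| Finset.measurable_sum _ fun j _ =>
        measurable_const.sub ((hfz i j).comp measurable_finCons)
    calc ∫ z, ⨆ i, (inner ℝ (w i) v + ∑ j, (∫ y, f i y ∂D - f i (z j)))
          ∂(Measure.pi fun _ : Fin (n + 1) => D)
        = ∫ x, ∫ z, ⨆ i, (inner ℝ (w i) v +
            ∑ j, (∫ y, f i y ∂D - f i ((Fin.cons x z : Fin (n + 1) → Ω) j)))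
              ∂(Measure.pi fun _ : Fin n => D) ∂D :=
          integral_pi_finSucc (.iSup fun i => measurable_const.add <|
            Finset.measurable_sum _ fun j _ => measurable_const.sub (hfz i j)) fun z => hsupB v z
      _ = ∫ z, ∫ x, ⨆ i, (inner ℝ (w i) v +
            ∑ j, (∫ y, f i y ∂D - f i ((Fin.cons x z : Fin (n + 1) → Ω) j)))
              ∂D ∂(Measure.pi fun _ : Fin n => D) :=
          integral_integral_swap (integrable_of_abs_le hL fun p => hsupB v _)
      _ ≤ ∫ z, ∫ x, (Φ 1 x z + Φ (-1) x z) / 2 ∂D ∂(Measure.pi fun _ : Fin n => D) := by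
          refine integral_mono
            (integrable_of_abs_le hL fun p => hsupB v _ :
              Integrable _ (D.prod (Measure.pi fun _ => D))).integral_prod_right
            hΦavg.integral_prod_right fun z => ?_
          have h := integral_ciSup_deviation_le (D := D) (fun i => hall i v z)
            hf hf1 hw hX hX1 hK hfK
          have e1 : ∀ x, Φ 1 x z = ⨆ i, ((inner ℝ (w i) v + ∑ j, (∫ y, f i y ∂D - f i (z j))) +
              2 * K * inner ℝ (w i) (X x)) := fun x => by
            rw [hΦ]
            refine iSup_congr fun i => ?_
            rw [inner_add_right, one_smul, inner_smul_right]
            ring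
          have e2 : ∀ x, Φ (-1) x z =
              ⨆ i, ((inner ℝ (w i) v + ∑ j, (∫ y, f i y ∂D - f i (z j))) -
                2 * K * inner ℝ (w i) (X x)) := fun x => by
            rw [hΦ]
            refine iSup_congr fun i => ?_
            rw [inner_add_right, inner_smul_right, inner_smul_right]
            ring
          simp only [e1, e2, Fin.sum_univ_succ, Fin.cons_zero, Fin.cons_succ]
          refine (integral_congr_ae (.of_forall fun x => iSup_congr fun i => ?_)).trans_le h
          show _ + (_ + _) = _ + _ + _
          rw [add_assoc, add_comm (∑ j, _)]
      _ = ∫ x, ∫ z, (Φ 1 x z + Φ (-1) x z) / 2 ∂(Measure.pi fun _ : Fin n => D) ∂D :=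
          (integral_integral_swap (f := fun x z => (Φ 1 x z + Φ (-1) x z) / 2) hΦavg).symm
      _ ≤ ∫ x, √(‖v‖ ^ 2 + (n + 1 : ℕ) * (2 * K) ^ 2) ∂D := by
          refine integral_mono hΦavg.integral_prod_left
            (integrable_const _) fun x => ?_
          show ∫ z, (Φ 1 x z + Φ (-1) x z) / 2 ∂(Measure.pi fun _ : Fin n => D) ≤ _
          have hi : ∀ s : ℝ, |s| = 1 → Integrable (Φ s x) (Measure.pi fun _ => D) := fun s hs =>
            integrable_of_abs_le ((hΦm s).comp measurable_prodMk_left) (hΦB s hs x)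
          rw [integral_div, integral_add (hi 1 h1) (hi (-1) h2)]
          have e1 := ih (v + (1 : ℝ) • ((2 * K) • X x))
          have e2 := ih (v + (-1 : ℝ) • ((2 * K) • X x))
          rw [one_smul] at e1
          rw [neg_one_smul, ← sub_eq_add_neg] at e2
          have e3 := sqrt_norm_add_add_sqrt_norm_sub_le v ((2 * K) • X x)
            (by positivity : 0 ≤ (n : ℝ) * (2 * K) ^ 2)
          have e4 : ‖(2 * K) • X x‖ ^ 2 ≤ (2 * K) ^ 2 := by
            rw [norm_smul, Real.norm_of_nonneg (by positivity : 0 ≤ 2 * K), mul_pow]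
            exact mul_le_of_le_one_right (by positivity)
              (pow_le_one₀ (norm_nonneg _) (hX1 x))
          have e5 : √(‖v‖ ^ 2 + ‖(2 * K) • X x‖ ^ 2 + n * (2 * K) ^ 2) ≤
              √(‖v‖ ^ 2 + (n + 1 : ℕ) * (2 * K) ^ 2) := by
            refine Real.sqrt_le_sqrt ?_
            push_cast
            linarith
          simp only [hΦ, one_smul, neg_one_smul, ← sub_eq_add_neg]
          linarith
      _ = _ := by simp

end UniformDeviation

/-! ### Uniform margin bounds over a unit ball -/

section MarginBound

variable {Ω : Type*} [MeasurableSpace Ω] {D : Measure Ω} [IsProbabilityMeasure D]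
  {H : Type*} [NormedAddCommGroup H] [InnerProductSpace ℝ H] [MeasurableSpace H] [BorelSpace H]
  [SecondCountableTopology H]

/-- High-probability version of `integral_ciSup_inner_add_sum_deviation_le`, from the bounded
differences inequality. -/
theorem exists_measurableSet_forall_integral_le_sum {ι : Type*} [Countable ι] [Nonempty ι]
    {f : ι → Ω → ℝ} (hf : ∀ i, Measurable (f i)) (hf01 : ∀ i x, f i x ∈ Set.Icc 0 1)
    {w : ι → H} (hw : ∀ i, ‖w i‖ ≤ 1) {X : Ω → H} (hX : Measurable X) (hX1 : ∀ x, ‖X x‖ ≤ 1)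
    {K : ℝ} (hK : 0 ≤ K)
    (hfK : ∀ i j x, |f i x - f j x| ≤ K * |inner ℝ (w i) (X x) - inner ℝ (w j) (X x)|)
    {n : ℕ} (hn : 1 ≤ n) {δ : ℝ} (hδ : 0 < δ) (hδ1 : δ ≤ 1) :
    ∃ A : Set (Fin n → Ω), MeasurableSet A ∧ (Measure.pi fun _ => D).real A ≤ δ ∧
      ∀ z ∉ A, ∀ i, n * ∫ x, f i x ∂D ≤
        ∑ j, f i (z j) + (2 * K * √n + √(n * Real.log (1 / δ) / 2)) := by
  have hf1 : ∀ i x, |f i x| ≤ 1 := fun i x => by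
    rw [abs_of_nonneg (hf01 i x).1]; exact (hf01 i x).2
  have hdev : ∀ i x, |∫ y, f i y ∂D - f i x| ≤ 2 := fun i x =>
    (abs_sub _ _).trans (by linarith [abs_integral_le_of_abs_le (μ := D) (hf1 i), hf1 i x])
  have hsum : ∀ i (z : Fin n → Ω), |∑ j, (∫ y, f i y ∂D - f i (z j))| ≤ n * 2 :=
    fun i z => (Finset.abs_sum_le_sum_abs _ _).trans
      ((Finset.sum_le_sum fun j _ => hdev i (z j)).trans (by simp))
  set Ψ : (Fin n → Ω) → ℝ := fun z => ⨆ i, ∑ j, (∫ y, f i y ∂D - f i (z j)) with hΨ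
  have hle : ∀ z i, ∑ j, (∫ y, f i y ∂D - f i (z j)) ≤ Ψ z := fun z i =>
    le_ciSup (bddAbove_range_of_abs_le fun i => hsum i z) i
  have hΨm : Measurable Ψ := .iSup fun i => Finset.measurable_sum _ fun j _ =>
    measurable_const.sub ((hf i).comp (measurable_pi_apply j))
  have hΨB : ∀ z, |Ψ z| ≤ n * 2 := fun z => abs_ciSup_le_of_abs_le fun i => hsum i z
  have hstep : ∀ z z' : Fin n → Ω, ∀ j, (∀ k, k ≠ j → z k = z' k) → Ψ z - Ψ z' ≤ 1 := by
    intro z z' j hz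
    rw [sub_le_iff_le_add']
    refine ciSup_le fun i => ?_
    have h1 : ∑ k, (∫ y, f i y ∂D - f i (z k)) - ∑ k, (∫ y, f i y ∂D - f i (z' k)) =
        f i (z' j) - f i (z j) := by
      rw [← Finset.sum_sub_distrib, Finset.sum_eq_single j]
      · ring
      · intro k _ hk
        rw [hz k hk, sub_self]
      · simp
    linarith [hle z' i, (hf01 i (z' j)).2, (hf01 i (z j)).1]
  have hd : ∀ z i x, |Ψ (Function.update z i x) - Ψ z| ≤ (1 : ℝ≥0) := by
    intro z i x
    have hne : ∀ k, k ≠ i → Function.update z i x k = z k := fun k hk =>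
      Function.update_of_ne hk x z
    rw [abs_le]
    constructor
    · have := hstep z (Function.update z i x) i fun k hk => (hne k hk).symm
      push_cast
      linarith
    · exact hstep (Function.update z i x) z i hne
  have hmean : ∫ z, Ψ z ∂(Measure.pi fun _ => D) ≤ 2 * K * √n := by
    have h := integral_ciSup_inner_add_sum_deviation_le (D := D) hf hf1 hw hX hX1 hK hfK n 0
    simp only [inner_zero_right, zero_add, norm_zero] at h
    refine h.trans_eq ?_
    rw [show (0 : ℝ) ^ 2 + n * (2 * K) ^ 2 = (2 * K) ^ 2 * n by ring,
      Real.sqrt_mul (by positivity), Real.sqrt_sq (by positivity)]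
  have hn0 : (0 : ℝ) < n := by exact_mod_cast hn
  have hlog : 0 ≤ Real.log (1 / δ) := Real.log_nonneg (one_le_one_div hδ hδ1)
  set s := √(n * Real.log (1 / δ) / 2) with hs
  refine ⟨{z | s ≤ Ψ z - ∫ y, Ψ y ∂(Measure.pi fun _ => D)},
    measurableSet_le measurable_const (hΨm.sub_const _), ?_, fun z hz i => ?_⟩
  · refine (measureReal_integral_add_le_of_boundedDifferences hΨm hΨB hd
      (Real.sqrt_nonneg _)).trans_eq ?_
    have : -s ^ 2 / (2 * (n * (((1 : ℝ≥0) : ℝ) ^ 2 / 4))) = Real.log δ := by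
      rw [hs, Real.sq_sqrt (by positivity), one_div, Real.log_inv]
      push_cast
      field_simp
      ring
    rw [this, Real.exp_log hδ]
  · have h1 : Ψ z - ∫ y, Ψ y ∂(Measure.pi fun _ => D) < s := not_le.1 hz
    have h2 := hle z i
    rw [Finset.sum_sub_distrib] at h2
    simp only [Finset.sum_const, Finset.card_univ, Fintype.card_fin, nsmul_eq_mul] at h2
    linarith

/-- The ramp loss: it is `1` on the negative half-line, `0` beyond `1`, and linear in between. -/
noncomputable def ramp (t : ℝ) : ℝ := max 0 (min 1 (1 - t))

theorem ramp_mem_Icc (t : ℝ) : ramp t ∈ Set.Icc 0 1 :=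
  ⟨le_max_left _ _, max_le zero_le_one (min_le_left _ _)⟩

theorem abs_ramp_sub_ramp_le (s t : ℝ) : |ramp s - ramp t| ≤ |s - t| := by
  refine (abs_max_sub_max_le_max _ _ _ _).trans (max_le (by simp) ?_)
  refine (abs_min_sub_min_le_max _ _ _ _).trans (max_le (by simp) ?_)
  rw [sub_sub_sub_cancel_left, abs_sub_comm]

theorem continuous_ramp : Continuous ramp := by
  unfold ramp
  fun_prop

theorem one_le_ramp {t : ℝ} (ht : t ≤ 0) : 1 ≤ ramp t :=
  le_max_of_le_right (le_min le_rfl (by linarith))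

theorem ramp_le_indicator (t : ℝ) : ramp t ≤ if t < 1 then 1 else 0 := by
  split_ifs with h
  · exact (ramp_mem_Icc t).2
  · exact max_le le_rfl (min_le_of_right_le (by linarith))

/-- The margin bound at a fixed scale `γ`, simultaneously for all weight vectors in the unit
ball. -/
theorem exists_measurableSet_forall_measureReal_le {X : Ω → H} (hX : Measurable X)
    (hX1 : ∀ x, ‖X x‖ ≤ 1) {γ : ℝ} (hγ : 0 < γ)
    {n : ℕ} (hn : 1 ≤ n) {δ : ℝ} (hδ : 0 < δ) (hδ1 : δ ≤ 1) :
    ∃ A : Set (Fin n → Ω), MeasurableSet A ∧ (Measure.pi fun _ => D).real A ≤ δ ∧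
      ∀ z ∉ A, ∀ u : H, ‖u‖ ≤ 1 → D.real {x | inner ℝ u (X x) ≤ 0} ≤
        (Nat.card {j : Fin n // inner ℝ u (X (z j)) < γ} : ℝ) / n +
          (2 / (γ * √n) + √(Real.log (1 / δ) / (2 * n))) := by
  classical
  have hn0 : (0 : ℝ) < n := by exact_mod_cast hn
  have hne : Nonempty (Metric.closedBall (0 : H) 1) := ⟨⟨0, by simp⟩⟩
  set f : H → Ω → ℝ := fun u x => ramp (inner ℝ u (X x) / γ) with hfdef
  have hfm : ∀ u, Measurable (f u) := fun u =>
    continuous_ramp.measurable.comp (by fun_prop)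
  have hf01 : ∀ u x, f u x ∈ Set.Icc 0 1 := fun u x => ramp_mem_Icc _
  have hf1 : ∀ u x, |f u x| ≤ 1 := fun u x => by
    rw [abs_of_nonneg (hf01 u x).1]; exact (hf01 u x).2
  have hfc : ∀ x, Continuous fun u => f u x := fun x =>
    continuous_ramp.comp (by fun_prop)
  obtain ⟨A, hA, hAδ, h⟩ := exists_measurableSet_forall_integral_le_sum (D := D)
    (f := fun i : ℕ => f (TopologicalSpace.denseSeq (Metric.closedBall (0 : H) 1) i))
    (fun i => hfm _) (fun i => hf01 _)
    (w := fun i => (TopologicalSpace.denseSeq (Metric.closedBall (0 : H) 1) i : H))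
    (fun i => mem_closedBall_zero_iff.1
      (TopologicalSpace.denseSeq (Metric.closedBall (0 : H) 1) i).2)
    hX hX1 (K := 1 / γ) (by positivity) (fun i j x => by
      refine (abs_ramp_sub_ramp_le _ _).trans_eq ?_
      rw [← sub_div, abs_div, abs_of_pos hγ]
      ring) hn hδ hδ1
  refine ⟨A, hA, hAδ, fun z hz u hu => ?_⟩
  -- The bound extends by continuity from a dense sequence to the whole ball.
  have hball : ∀ v : Metric.closedBall (0 : H) 1, n * ∫ x, f v x ∂D ≤
      ∑ j, f v (z j) + (2 * (1 / γ) * √n + √(n * Real.log (1 / δ) / 2)) := by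
    have hclosed : IsClosed {v : Metric.closedBall (0 : H) 1 | n * ∫ x, f v x ∂D ≤
        ∑ j, f v (z j) + (2 * (1 / γ) * √n + √(n * Real.log (1 / δ) / 2))} := by
      refine isClosed_le (continuous_const.mul ?_) (.add ?_ continuous_const)
      · exact continuous_of_dominated (bound := fun _ => 1)
          (fun v => (hfm v).aestronglyMeasurable) (fun v => .of_forall (hf1 v))
          (integrable_const _) (.of_forall fun x => (hfc x).comp continuous_subtype_val)
      · exact continuous_finsetSum _ fun j _ => (hfc (z j)).comp continuous_subtype_val
    intro v
    have hd := (TopologicalSpace.denseRange_denseSeq (Metric.closedBall (0 : H) 1)).closure_eq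
    have := closure_minimal (s := Set.range (TopologicalSpace.denseSeq _))
      (by rintro _ ⟨i, rfl⟩; exact h z hz i) hclosed
    rw [hd] at this
    exact this (Set.mem_univ v)
  have hu' := hball ⟨u, by simpa using hu⟩
  have hR : D.real {x | inner ℝ u (X x) ≤ 0} ≤ ∫ x, f u x ∂D := by
    have hm : MeasurableSet {x | (inner ℝ u (X x) : ℝ) ≤ 0} :=
      measurableSet_le (by fun_prop) measurable_const
    rw [← integral_indicator_one hm]
    refine integral_mono ((integrable_const (1 : ℝ)).indicator hm)
      (integrable_of_abs_le (hfm u) (hf1 u)) fun x => ?_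
    refine Set.indicator_apply_le' (fun hx => ?_) fun _ => (hf01 u x).1
    exact one_le_ramp (div_nonpos_of_nonpos_of_nonneg hx hγ.le)
  have hE : ∑ j, f u (z j) ≤ Nat.card {j : Fin n // inner ℝ u (X (z j)) < γ} := by
    rw [Nat.card_eq_fintype_card, Fintype.card_subtype, Finset.card_filter]
    push_cast
    refine Finset.sum_le_sum fun j _ => ?_
    simpa only [div_lt_one hγ] using ramp_le_indicator (inner ℝ u (X (z j)) / γ)
  have e1 : 2 / (γ * √n) = 2 * (1 / γ) * √n / n := by
    have := Real.sq_sqrt hn0.le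
    have h0 : 0 < √(n : ℝ) := Real.sqrt_pos.2 hn0
    field_simp
    linarith
  have e2 : √(Real.log (1 / δ) / (2 * n)) = √(n * Real.log (1 / δ) / 2) / n := by
    rw [eq_div_iff hn0.ne']
    nth_rewrite 2 [← Real.sqrt_sq hn0.le]
    rw [← Real.sqrt_mul' _ (by positivity)]
    congr 1
    field_simp
  rw [e1, e2, ← add_div, ← add_div, le_div_iff₀ hn0]
  have := mul_le_mul_of_nonneg_left hR hn0.le
  simp only at hu'
  linarith

theorem measureReal_iUnion_le_of_hasSum {α : Type*} [MeasurableSpace α] {μ : Measure α}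
    [IsFiniteMeasure μ] {A : ℕ → Set α} {a : ℕ → ℝ} {s : ℝ} (hA : ∀ k, μ.real (A k) ≤ a k)
    (hs : HasSum a s) : μ.real (⋃ k, A k) ≤ s := by
  have ha : ∀ k, 0 ≤ a k := fun k => measureReal_nonneg.trans (hA k)
  refine ENNReal.toReal_le_of_le_ofReal (hs.nonneg ha) ?_
  rw [← hs.tsum_eq, ENNReal.ofReal_tsum_of_nonneg ha hs.summable]
  refine (measure_iUnion_le A).trans (ENNReal.tsum_le_tsum fun k => ?_)
  rw [← ofReal_measureReal]
  exact ENNReal.ofReal_le_ofReal (hA k)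

theorem sqrt_add_le_add_sqrt {a b : ℝ} (ha : 0 ≤ a) (hb : 0 ≤ b) : √(a + b) ≤ √a + √b := by
  refine (Real.sqrt_le_left (by positivity)).2 ?_
  nlinarith [Real.sq_sqrt ha, Real.sq_sqrt hb, mul_nonneg (Real.sqrt_nonneg a) (Real.sqrt_nonneg b)]

theorem sqrt_succ_div_two_le (k : ℕ) : √(((k : ℝ) + 1) / 2) ≤ 2 ^ k := by
  refine (Real.sqrt_le_left (by positivity)).2 ?_
  have h1 : ((k : ℝ) + 1) ≤ 2 ^ k := by exact_mod_cast Nat.succ_le_of_lt k.lt_two_pow_self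
  have h2 : (1 : ℝ) ≤ 2 ^ k := one_le_pow₀ one_le_two
  nlinarith

/-- The margin bound, simultaneously for all scales `γ ≤ 1`. The union is over the dyadic scales,
and its price is absorbed into the term `1 / (γ √n)`. -/
theorem exists_measurableSet_forall_margin {X : Ω → H} (hX : Measurable X)
    (hX1 : ∀ x, ‖X x‖ ≤ 1) {n : ℕ} (hn : 1 ≤ n) {δ : ℝ} (hδ : 0 < δ) (hδ1 : δ ≤ 1) :
    ∃ A : Set (Fin n → Ω), MeasurableSet A ∧ (Measure.pi fun _ => D).real A ≤ δ ∧
      ∀ z ∉ A, ∀ u : H, ‖u‖ ≤ 1 → ∀ γ : ℝ, 0 < γ → γ ≤ 1 →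
        D.real {x | inner ℝ u (X x) ≤ 0} ≤
          (Nat.card {j : Fin n // inner ℝ u (X (z j)) < γ} : ℝ) / n +
            (5 / (γ * √n) + √(Real.log (1 / δ) / (2 * n))) := by
  have hn0 : (0 : ℝ) < n := by exact_mod_cast hn
  have hδk1 : ∀ k : ℕ, δ / 2 / 2 ^ k ≤ 1 := fun k => by
    have h2 : (1 : ℝ) ≤ 2 ^ k := one_le_pow₀ one_le_two
    rw [div_div, div_le_one (by positivity)]
    linarith
  choose A hA hAδ h using fun k : ℕ => exists_measurableSet_forall_measureReal_le (D := D) hX hX1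
    (γ := (1 / 2) ^ (k + 1)) (by positivity) hn (δ := δ / 2 / 2 ^ k) (by positivity) (hδk1 k)
  refine ⟨⋃ k, A k, .iUnion hA,
    measureReal_iUnion_le_of_hasSum hAδ (hasSum_geometric_two' δ), ?_⟩
  intro z hz u hu γ hγ hγ1
  obtain ⟨k, hk, hk'⟩ := exists_nat_pow_near_of_lt_one hγ hγ1
    (by norm_num : (0 : ℝ) < 1 / 2) (by norm_num)
  have hzk : z ∉ A k := fun hmem => hz (Set.mem_iUnion.2 ⟨k, hmem⟩)
  refine (h k z hzk u hu).trans ?_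
  have h2k : (2 : ℝ) ^ k ≤ 1 / γ := by
    rw [le_div_iff₀ hγ]
    calc (2 : ℝ) ^ k * γ ≤ 2 ^ k * (1 / 2) ^ k := by gcongr
      _ = 1 := by rw [← mul_pow]; norm_num
  refine add_le_add ?_ ?_
  · refine div_le_div_of_nonneg_right ?_ hn0.le
    exact_mod_cast Nat.card_le_card_of_injective
      (fun j : {j : Fin n // inner ℝ u (X (z j)) < (1 / 2) ^ (k + 1)} =>
        (⟨j.1, j.2.trans hk⟩ : {j : Fin n // inner ℝ u (X (z j)) < γ}))
      fun i j hij => Subtype.ext (congrArg (fun t => t.1) hij)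
  · have h0 : 0 < √(n : ℝ) := Real.sqrt_pos.2 hn0
    have e1 : 2 / ((1 / 2) ^ (k + 1) * √n) ≤ 4 / (γ * √n) := by
      have : 2 / ((1 / 2) ^ (k + 1) * √(n : ℝ)) = 4 * 2 ^ k / √n := by
        rw [one_div, inv_pow]
        field_simp
        ring
      rw [this, show 4 / (γ * √(n : ℝ)) = 4 * (1 / γ) / √n by field_simp]
      gcongr
    have hlog : 0 ≤ Real.log (1 / δ) := Real.log_nonneg (one_le_one_div hδ hδ1)
    have e2 : √(Real.log (1 / (δ / 2 / 2 ^ k)) / (2 * n)) ≤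
        1 / (γ * √n) + √(Real.log (1 / δ) / (2 * n)) := by
      have e3 : Real.log (1 / (δ / 2 / 2 ^ k)) = (k + 1) * Real.log 2 + Real.log (1 / δ) := by
        rw [show 1 / (δ / 2 / 2 ^ k) = 2 ^ (k + 1) * (1 / δ) by field_simp; ring,
          Real.log_mul (by positivity) (by positivity), Real.log_pow]
        push_cast
        ring
      have e4 : Real.log (1 / (δ / 2 / 2 ^ k)) / (2 * n) ≤
          (k + 1) / 2 / n + Real.log (1 / δ) / (2 * n) := by
        rw [e3, add_div, div_div]
        have : Real.log 2 ≤ 1 := Real.log_two_lt_d9.le.trans (by norm_num)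
        gcongr
        exact mul_le_of_le_one_right (by positivity) this
      refine (Real.sqrt_le_sqrt e4).trans ((sqrt_add_le_add_sqrt (by positivity)
        (by positivity)).trans (add_le_add ?_ le_rfl))
      rw [Real.sqrt_div (by positivity), show 1 / (γ * √(n : ℝ)) = 1 / γ / √n by field_simp]
      gcongr
      exact (sqrt_succ_div_two_le k).trans h2k
    have e5 : 5 / (γ * √(n : ℝ)) = 4 / (γ * √n) + 1 / (γ * √n) := by ring
    linarith

end MarginBound

/-! ### The embedding: measurability and norm -/

section Embedding

variable {d : ℕ}

theorem Cell.mem_region_iff (b : Cell d) (x : EuclideanSpace ℝ (Fin d)) :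
    x ∈ b.region ↔ ∀ i, 0 ≤ b.coord i x := by
  rw [Cell.region, AffineBasis.convexHull_eq_nonneg_coord]
  rfl

theorem Cell.measurableSet_region (b : Cell d) : MeasurableSet b.region :=
  ((Set.finite_range b).isClosed_convexHull ℝ).measurableSet

theorem Cell.measurable_coord (b : Cell d) (i : Fin (d + 1)) : Measurable (b.coord i) :=
  (continuous_barycentric_coord b i).measurable

theorem Cell.barycenter_eq_sum (b : Cell d) : b.barycenter = ∑ i, ((d : ℝ) + 1)⁻¹ • b i := by
  rw [Cell.barycenter, Finset.centroid_def,
    Finset.affineCombination_eq_linear_combination _ _ _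
      (Finset.sum_centroidWeights_eq_one_of_nonempty ℝ _ Finset.univ_nonempty)]
  simp [Finset.centroidWeights_apply]

/-- The subsimplices of a simplex cover it: a point lies in the one that replaces the vertex at
which its barycentric coordinate is smallest. -/
theorem Cell.exists_mem_region_split (b : Cell d) {x : EuclideanSpace ℝ (Fin d)}
    (hx : x ∈ b.region) : ∃ j, x ∈ (b.split j).region := by
  obtain ⟨j, hj⟩ := Finite.exists_min fun i => b.coord i x
  have hj0 : 0 ≤ b.coord j x := (b.mem_region_iff x).1 hx j
  refine ⟨j, ?_⟩
  have hsplit : ∀ i, b.split j i = Function.update b j b.barycenter i := fun i => rfl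
  -- The weights of `x` with respect to the vertices of the subsimplex.
  set a : Fin (d + 1) → ℝ := fun i =>
    if i = j then (d + 1) * b.coord j x else b.coord i x - b.coord j x with ha
  have hsum : ∑ i, b.coord i x = 1 := b.sum_coord_apply_eq_one x
  have hlin : ∑ i, b.coord i x • b i = x := b.linear_combination_coord_eq_self x
  have ha_eq : ∀ i, a i = (b.coord i x - b.coord j x) +
      if i = j then (d + 1) * b.coord j x else 0 := fun i => by
    by_cases h : i = j <;> simp [ha, h]
  have ha1 : ∑ i, a i = 1 := by
    simp only [ha_eq, Finset.sum_add_distrib, Finset.sum_sub_distrib, hsum]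
    simp
  have hax : ∑ i, a i • b.split j i = x := by
    have h1 : ∀ i, a i • b.split j i = (b.coord i x • b i - b.coord j x • b i) +
        if i = j then ((d + 1) * b.coord j x) • b.barycenter else 0 := fun i => by
      by_cases h : i = j
      · subst h
        simp [ha, hsplit]
      · simp [ha, hsplit, h, sub_smul]
    simp only [h1, Finset.sum_add_distrib, Finset.sum_sub_distrib, hlin]
    simp only [Finset.sum_ite_eq', Finset.mem_univ, if_true, b.barycenter_eq_sum]
    rw [← Finset.smul_sum, ← Finset.smul_sum, smul_smul]
    have : (((d : ℝ) + 1) * b.coord j x) * ((d : ℝ) + 1)⁻¹ = b.coord j x := by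
      field_simp
    rw [this]
    abel
  rw [← hax]
  refine (convex_convexHull ℝ _).sum_mem (fun i _ => ?_) ha1
    fun i _ => subset_convexHull ℝ _ (Set.mem_range_self i)
  by_cases h : i = j
  · simp only [ha, h, if_true]
    positivity
  · simp only [ha, h, if_false]
    exact sub_nonneg.2 (hj i)

theorem mem_region_locate (S : Cell d) {x : EuclideanSpace ℝ (Fin d)} (hx : x ∈ S.region)
    (q : ℕ) : x ∈ (locate S q x).region := by
  induction q with
  | zero => exact hx
  | succ q ih =>
    have h := (locate S q x).exists_mem_region_split ih
    show x ∈ ((locate S q x).child x).region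
    rw [Cell.child, dif_pos h]
    classical
    exact Fin.find_spec h

theorem locate_mem_cells (S : Cell d) (q : ℕ) (x : EuclideanSpace ℝ (Fin d)) :
    locate S q x ∈ cells S q := by
  classical
  induction q with
  | zero => simp [locate, cells]
  | succ q ih =>
    simp only [locate, cells, Finset.mem_biUnion, Finset.mem_image, Finset.mem_univ, true_and]
    refine ⟨_, ih, ?_⟩
    rw [Cell.child]
    split_ifs with h
    · exact ⟨_, rfl⟩
    · exact ⟨_, rfl⟩

/-- The subsimplex `b.child x` depends only on which of the finitely many (measurable) regions
contain `x`. -/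
theorem Cell.measurableSet_child_eq (b c : Cell d) :
    MeasurableSet {x : EuclideanSpace ℝ (Fin d) | b.child x = c} := by
  classical
  let choice : (Fin (d + 1) → Prop) → Cell d := fun p =>
    if h : ∃ j, p j then b.split (Fin.find p h) else b.split 0
  have hm : Measurable fun (x : EuclideanSpace ℝ (Fin d)) (j : Fin (d + 1)) =>
      x ∈ (b.split j).region :=
    measurable_pi_iff.2 fun j => measurable_mem.2 (b.split j).measurableSet_region
  have : {x | b.child x = c} = (fun (x : EuclideanSpace ℝ (Fin d)) (j : Fin (d + 1)) =>
      x ∈ (b.split j).region) ⁻¹' {p | choice p = c} := by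
    ext x
    simp only [Set.mem_ofPred_eq, Set.mem_preimage, choice, Cell.child]
  rw [this]
  exact hm (Set.toFinite _).measurableSet

theorem measurableSet_locate_eq (S : Cell d) (q : ℕ) :
    ∀ c : Cell d, MeasurableSet {x : EuclideanSpace ℝ (Fin d) | locate S q x = c} := by
  induction q with
  | zero => exact fun c => MeasurableSet.const (S = c)
  | succ q ih =>
    intro c
    have : {x | locate S (q + 1) x = c} =
        ⋃ b ∈ cells S q, {x | locate S q x = b} ∩ {x | b.child x = c} := by
      ext x
      simp only [locate, Set.mem_ofPred_eq, Set.mem_iUnion, Set.mem_inter_iff, exists_prop]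
      constructor
      · exact fun h => ⟨_, locate_mem_cells S q x, rfl, h⟩
      · rintro ⟨b, -, rfl, h⟩
        exact h
    rw [this]
    exact Finset.measurableSet_biUnion _ fun b _ => (ih b).inter (b.measurableSet_child_eq c)

theorem measurable_embed (S : Cell d) (q : ℕ) : Measurable (embed S q) := by
  classical
  refine (WithLp.measurable_toLp 2 _).comp (measurable_pi_iff.2 fun p => ?_)
  have : (fun x => ∑ i, if locate S q x i = (p : EuclideanSpace ℝ (Fin d)) then
        (locate S q x).coord i x else 0) =
      fun x => ∑ c ∈ cells S q, {y | locate S q y = c}.indicator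
        (fun x => ∑ i, if c i = (p : EuclideanSpace ℝ (Fin d)) then c.coord i x else 0) x := by
    funext x
    rw [Finset.sum_eq_single_of_mem _ (locate_mem_cells S q x)]
    · rw [Set.indicator_of_mem (by rfl : x ∈ {y | locate S q y = locate S q x})]
    · exact fun c _ hc => Set.indicator_of_notMem (fun h => hc h.symm) _
  rw [this]
  refine Finset.measurable_sum _ fun c _ => Measurable.indicator ?_ (measurableSet_locate_eq S q c)
  refine Finset.measurable_sum _ fun i _ => ?_
  split_ifs
  · exact c.measurable_coord i
  · exact measurable_const

/-- On `S` the coordinates of the embedding are nonnegative and sum to at most `1`. -/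
theorem norm_embed_le (S : Cell d) (q : ℕ) {x : EuclideanSpace ℝ (Fin d)} (hx : x ∈ S.region) :
    ‖embed S q x‖ ≤ 1 := by
  classical
  set b := locate S q x with hb
  have h0 : ∀ i, 0 ≤ b.coord i x := (b.mem_region_iff x).1 (mem_region_locate S hx q)
  have hp : ∀ p, embed S q x p =
      ∑ i, if b i = (p : EuclideanSpace ℝ (Fin d)) then b.coord i x else 0 := fun p => by
    simp only [embed, hb]
  have hpos : ∀ p, 0 ≤ embed S q x p := fun p => by
    rw [hp]
    exact Finset.sum_nonneg fun i _ => by split_ifs <;> simp [h0 i]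
  have hle : ∑ p, embed S q x p ≤ 1 := by
    simp only [hp]
    rw [Finset.sum_comm, ← b.sum_coord_apply_eq_one x]
    refine Finset.sum_le_sum fun i _ => ?_
    by_cases h : b i ∈ points S q
    · rw [Finset.sum_eq_single (⟨b i, h⟩ : points S q)]
      · simp
      · exact fun p _ hp => if_neg fun h' => hp (Subtype.ext h'.symm)
      · simp
    · rw [Finset.sum_eq_zero]
      · exact h0 i
      · exact fun p _ => if_neg fun h' => h (by rw [h']; exact p.2)
  rw [EuclideanSpace.norm_eq, Real.sqrt_le_one]
  calc ∑ p, ‖embed S q x p‖ ^ 2 ≤ ∑ p, embed S q x p := by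
        refine Finset.sum_le_sum fun p _ => ?_
        rw [Real.norm_of_nonneg (hpos p), sq]
        exact mul_le_of_le_one_left (hpos p)
          ((Finset.single_le_sum (fun p _ => hpos p) (Finset.mem_univ p)).trans hle)
    _ ≤ 1 := hle

end Embedding

/-! ### The bound for all stages -/

section Stages

variable {d : ℕ}

open Classical in
/-- The embedded point multiplied by its label, so that the classifier given by `w` errs on a
labelled point in `S × {-1, 1}` exactly when its inner product with `w` is nonpositive. Points of
norm above `1`, which occur only outside `S × {-1, 1}`, are sent to `0`. -/
noncomputable def signedEmbed (S : Cell d) (q : ℕ) (z : EuclideanSpace ℝ (Fin d) × ℝ) :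
    EuclideanSpace ℝ (points S q) :=
  if ‖z.2 • embed S q z.1‖ ≤ 1 then z.2 • embed S q z.1 else 0

theorem measurable_signedEmbed (S : Cell d) (q : ℕ) : Measurable (signedEmbed S q) := by
  have h : Measurable fun z : EuclideanSpace ℝ (Fin d) × ℝ => z.2 • embed S q z.1 :=
    measurable_snd.smul ((measurable_embed S q).comp measurable_fst)
  exact Measurable.ite (measurableSet_le h.norm measurable_const) h measurable_const

theorem norm_signedEmbed_le (S : Cell d) (q : ℕ) (z : EuclideanSpace ℝ (Fin d) × ℝ) :
    ‖signedEmbed S q z‖ ≤ 1 := by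
  unfold signedEmbed
  split_ifs with h
  · exact h
  · simp

theorem signedEmbed_eq (S : Cell d) (q : ℕ) {z : EuclideanSpace ℝ (Fin d) × ℝ}
    (hz : z.1 ∈ S.region ∧ (z.2 = 1 ∨ z.2 = -1)) :
    signedEmbed S q z = z.2 • embed S q z.1 := by
  refine if_pos ?_
  have h : ‖z.2‖ = 1 := by rcases hz.2 with h | h <;> simp [h]
  rw [norm_smul, h, one_mul]
  exact norm_embed_le S q hz.1

theorem hasSum_div_succ_mul_succ_succ (δ : ℝ) (hδ : 0 ≤ δ) :
    HasSum (fun m : ℕ => δ / (((m : ℝ) + 1) * (m + 2))) δ := by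
  rw [hasSum_iff_tendsto_nat_of_nonneg fun m => by positivity]
  have h : ∀ n : ℕ, ∑ m ∈ Finset.range n, δ / (((m : ℝ) + 1) * (m + 2)) =
      δ - δ * (1 / ((n : ℝ) + 1)) := by
    intro n
    induction n with
    | zero => simp
    | succ n ih =>
      rw [Finset.sum_range_succ, ih]
      push_cast
      field_simp
      ring
  simp only [h]
  simpa using tendsto_const_nhds.sub
    ((tendsto_one_div_add_atTop_nhds_zero_nat (𝕜 := ℝ)).const_mul δ)

/-- The confidence term at stage `m + 1`, whose share of the failure probability is
`δ / ((m + 1) (m + 2))`. -/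
theorem sqrt_log_stage_le (m : ℕ) {n : ℕ} (hn : 1 ≤ n) {δ : ℝ} (hδ : 0 < δ) (hδ1 : δ ≤ 1) :
    √(Real.log (1 / (δ / (((m : ℝ) + 1) * (m + 2)))) / (2 * n)) ≤
      1 / √n + √(Real.log (((m + 1 : ℕ) : ℝ) / δ) / n) := by
  have hn0 : (0 : ℝ) < n := by exact_mod_cast hn
  have hm0 : (0 : ℝ) ≤ m := m.cast_nonneg
  have hlog0 : 0 ≤ Real.log (((m + 1 : ℕ) : ℝ) / δ) := Real.log_nonneg <| by
    rw [one_le_div hδ]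
    push_cast
    linarith
  have hlog : Real.log (1 / (δ / (((m : ℝ) + 1) * (m + 2)))) ≤
      2 + 2 * Real.log (((m + 1 : ℕ) : ℝ) / δ) := by
    have h1 : 1 / (δ / (((m : ℝ) + 1) * (m + 2))) ≤ 2 * (((m + 1 : ℕ) : ℝ) / δ) ^ 2 := by
      push_cast
      rw [one_div_div, div_pow, mul_div_assoc', div_le_div_iff₀ hδ (by positivity)]
      have h2 : ((m : ℝ) + 1) * (m + 2) ≤ 2 * ((m : ℝ) + 1) ^ 2 := by nlinarith
      exact mul_le_mul h2 (by nlinarith) (by positivity) (by positivity)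
    refine (Real.log_le_log (by positivity) h1).trans ?_
    rw [Real.log_mul two_ne_zero (by positivity), Real.log_pow]
    have : Real.log 2 ≤ 1 := Real.log_two_lt_d9.le.trans (by norm_num)
    push_cast
    linarith
  calc √(Real.log (1 / (δ / (((m : ℝ) + 1) * (m + 2)))) / (2 * n))
      ≤ √(1 / n + Real.log (((m + 1 : ℕ) : ℝ) / δ) / n) := by
        refine Real.sqrt_le_sqrt ?_
        rw [← add_div, div_le_div_iff₀ (by positivity) hn0]
        nlinarith
    _ ≤ √(1 / n) + √(Real.log (((m + 1 : ℕ) : ℝ) / δ) / n) :=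
        sqrt_add_le_add_sqrt (by positivity) (by positivity)
    _ = _ := by rw [Real.sqrt_div zero_le_one, Real.sqrt_one]

/-- A tie counts as an error, so an error forces `y ⟪w, φ x⟫ ≤ 0`. -/
theorem mul_inner_nonpos_of_sign_ne {y t : ℝ} (hy : y = 1 ∨ y = -1) (h : Real.sign t ≠ y) :
    y * t ≤ 0 := by
  by_contra! hlt
  rcases hy with rfl | rfl
  · exact h (Real.sign_of_pos (by linarith))
  · exact h (Real.sign_of_neg (by linarith))

end Stages

end NestedBarycentric

open NestedBarycentric in
theorem theorem3 :
    ∃ C : ℝ, 0 < C ∧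
      ∀ (d : ℕ) (S : NestedBarycentric.Cell d)
        (D : Measure (EuclideanSpace ℝ (Fin d) × ℝ)) [IsProbabilityMeasure D],
        (∀ᵐ z ∂D, z.1 ∈ S.region ∧ (z.2 = 1 ∨ z.2 = -1)) →
        ∀ (n : ℕ), 1 ≤ n → ∀ (δ : ℝ), 0 < δ → δ < 1 →
          ∃ G : Set (Fin n → EuclideanSpace ℝ (Fin d) × ℝ),
            MeasurableSet G ∧
            1 - δ ≤ (Measure.pi fun _ : Fin n => D).real G ∧
            ∀ z ∈ G, ∀ (q : ℕ), 1 ≤ q →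
              ∀ (w : EuclideanSpace ℝ (NestedBarycentric.points S q)) (γ : ℝ), 0 < γ →
                NestedBarycentric.generalizationError S q w D ≤
                  NestedBarycentric.empiricalMarginError S q w γ z +
                    C * (1 / (γ * √(n : ℝ)) + √(Real.log ((q : ℝ) / δ) / n)) := by
  refine ⟨6, by norm_num, fun d S D _ hD n hn δ hδ hδ1 => ?_⟩
  have hn0 : (0 : ℝ) < n := by exact_mod_cast hn
  -- Stage `m + 1` gets the share `δ / ((m + 1) (m + 2))` of the failure probability.
  have hδm : ∀ m : ℕ, δ / (((m : ℝ) + 1) * (m + 2)) ≤ 1 := fun m => by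
    rw [div_le_one (by positivity)]
    nlinarith [(m.cast_nonneg : (0 : ℝ) ≤ m)]
  choose A hA hAδ h using fun m : ℕ => exists_measurableSet_forall_margin (D := D)
    (measurable_signedEmbed S (m + 1)) (norm_signedEmbed_le S (m + 1)) hn
    (δ := δ / (((m : ℝ) + 1) * (m + 2))) (by positivity) (hδm m)
  set T : Set (EuclideanSpace ℝ (Fin d) × ℝ) := S.region ×ˢ {1, -1} with hT
  have hTm : MeasurableSet T := S.measurableSet_region.prod (Set.toFinite _).measurableSet
  have hTmem : ∀ z : EuclideanSpace ℝ (Fin d) × ℝ,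
      z ∈ T ↔ z.1 ∈ S.region ∧ (z.2 = 1 ∨ z.2 = -1) := fun z => by
    simp [hT, Set.mem_prod]
  have hDT : ∀ᵐ z ∂(Measure.pi fun _ : Fin n => D), ∀ j, z j ∈ T :=
    ae_all_iff.2 fun j => (measurePreserving_eval (fun _ : Fin n => D) j).quasiMeasurePreserving.ae
      (hD.mono fun z hz => (hTmem z).2 hz)
  have hUm : MeasurableSet (⋃ m, A m) := .iUnion hA
  have hTall : MeasurableSet {z : Fin n → EuclideanSpace ℝ (Fin d) × ℝ | ∀ j, z j ∈ T} := by
    rw [Set.ofPred_forall]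
    exact .iInter fun j => measurable_pi_apply j hTm
  refine ⟨(⋃ m, A m)ᶜ ∩ {z | ∀ j, z j ∈ T}, hUm.compl.inter hTall, ?_, ?_⟩
  · have hU : 1 - δ ≤ (Measure.pi fun _ : Fin n => D).real (⋃ m, A m)ᶜ := by
      rw [probReal_compl_eq_one_sub hUm]
      have := measureReal_iUnion_le_of_hasSum hAδ (hasSum_div_succ_mul_succ_succ δ hδ.le)
      linarith
    exact hU.trans <| ENNReal.toReal_mono (measure_ne_top _ _) <|
      measure_mono_ae <| hDT.mono fun z hz hzA => ⟨hzA, hz⟩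
  rintro z ⟨hzA, hzT⟩ q hq w γ hγ
  obtain ⟨m, rfl⟩ : ∃ m, q = m + 1 := ⟨q - 1, by omega⟩
  have hrate : 0 ≤ 6 * (1 / (γ * √(n : ℝ)) + √(Real.log (((m + 1 : ℕ) : ℝ) / δ) / n)) := by
    positivity
  have hmargin : ∀ p, p ∈ T → margin S (m + 1) w p =
      inner ℝ (‖w‖⁻¹ • w) (signedEmbed S (m + 1) p) := fun p hp => by
    rw [signedEmbed_eq S (m + 1) ((hTmem p).1 hp), margin, real_inner_smul_left,
      real_inner_smul_right, div_eq_inv_mul]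
  have hu : ‖‖w‖⁻¹ • w‖ ≤ 1 := by
    rw [norm_smul, norm_inv, norm_norm]
    exact inv_mul_le_one
  by_cases htriv : ∀ j, margin S (m + 1) w (z j) < γ
  · -- All sample points violate the margin, so the bound is at least `1`.
    have h1 : empiricalMarginError S (m + 1) w γ z = 1 := by
      have : Nat.card {i : Fin n // margin S (m + 1) w (z i) < γ} = n := by
        rw [Nat.card_congr (Equiv.subtypeUnivEquiv htriv), Nat.card_fin]
      rw [empiricalMarginError, this, div_self hn0.ne']
    have h2 : generalizationError S (m + 1) w D ≤ 1 := measureReal_le_one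
    linarith
  obtain ⟨j, hj⟩ := not_forall.1 htriv
  rw [not_lt, hmargin _ (hzT j)] at hj
  have hw : w ≠ 0 := by
    rintro rfl
    simp only [smul_zero, inner_zero_left] at hj
    linarith
  have hγ1 : γ ≤ 1 := hj.trans <| (real_inner_le_norm _ _).trans <|
    mul_le_one₀ hu (norm_nonneg _) (norm_signedEmbed_le S (m + 1) (z j))
  have hzm : z ∉ A m := fun hmem => hzA (Set.mem_iUnion.2 ⟨m, hmem⟩)
  have hmain := h m z hzm (‖w‖⁻¹ • w) hu γ hγ hγ1
  have hR : generalizationError S (m + 1) w D ≤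
      D.real {p | inner ℝ (‖w‖⁻¹ • w) (signedEmbed S (m + 1) p) ≤ 0} := by
    refine ENNReal.toReal_mono (measure_ne_top _ _) (measure_mono_ae (hD.mono fun p hp hne => ?_))
    show inner ℝ (‖w‖⁻¹ • w) (signedEmbed S (m + 1) p) ≤ 0
    rw [← hmargin p ((hTmem p).2 hp)]
    exact div_nonpos_of_nonpos_of_nonneg (mul_inner_nonpos_of_sign_ne hp.2 hne) (norm_nonneg w)
  have hE : (Nat.card {j : Fin n //
      inner ℝ (‖w‖⁻¹ • w) (signedEmbed S (m + 1) (z j)) < γ} : ℝ) / n =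
        empiricalMarginError S (m + 1) w γ z := by
    simp only [empiricalMarginError, hmargin _ (hzT _)]
  rw [hE] at hmain
  have hlog := sqrt_log_stage_le m hn hδ hδ1.le
  have h1 : 1 / √(n : ℝ) ≤ 1 / (γ * √n) := by
    have : 0 < √(n : ℝ) := Real.sqrt_pos.2 hn0
    exact one_div_le_one_div_of_le (by positivity) (mul_le_of_le_one_left this.le hγ1)
  have h2 : 5 / (γ * √(n : ℝ)) = 5 * (1 / (γ * √n)) := by ring
  have h3 : 0 ≤ √(Real.log (((m + 1 : ℕ) : ℝ) / δ) / n) := Real.sqrt_nonneg _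
  linarith
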